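/- For a Boolean function $f:\mathbb{Z}_2^n\to\mathbb{Z}_2$ and a permutation $\sigma\in\mathcal{S}_n$ let $f_\sigma(x_1,\dots,x_n)=f(x_{\sigma(1)},\dots,x_{\sigma(n)})$. Two functions $g,h:\mathbb{Z}_2^n\to\mathbb{Z}_2$ are $\varepsilon$-close if $\Pr_x[g(x)\ne h(x)]\le\varepsilon$ for uniformly random $x\in\mathbb{Z}_2^n$. A $k$-junta is a function $f:\mathbb{Z}_2^n\to\mathbb{Z}_2$ that depends on at most $k$ of its $n$ variables. The function $f$ is locally correctable from noise rate $\varepsilon$ using $q$ non-adaptive queries if there is a randomized algorithm (which may depend on $f$) such that for every $\sigma\in\mathcal{S}_n$, every $g$ that is $\varepsilon$-close to $f_\sigma$, and every $x\in\mathbb{Z}_2^n$, the algorithm, given $x$ and oracle access to $g$, makes $q$ queries to $g$, chosen in advance independently of the answers, and outputs $f_\sigma(x)$ with probability at least $2/3$. Theorem. Almost every $k$-junta can be locally corrected from the constant noise rate $\varepsilon=0.001$ using $O(k\log^2 k)$ non-adaptive queries. That is, there are a function $q:\mathbb{N}\to\mathbb{N}$ with $q(k)=O(k\log^2 k)$ as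 $k\to\infty$ and a sequence $\delta_k\to 0$ such that for all $k$ and all $n\ge k$, at most a $\delta_k$ fraction of the $k$-juntas $f:\mathbb{Z}_2^n\to\mathbb{Z}_2$ fail to be locally correctable from noise rate $0.001$ using $q(k)$ non-adaptive queries. -/

import Mathlib

open Filter Topology Asymptotics

/-- Boolean functions of `n` variables, i.e. maps from `ℤ₂ⁿ` to `ℤ₂`. -/
abbrev BoolFun (n : ℕ) : Type := (Fin n → ZMod 2) → ZMod 2

/-- The isomorphic copy `f_σ(x₁, …, xₙ) = f(x_{σ(1)}, …, x_{σ(n)})` of `f`. -/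
def BoolFun.iso {n : ℕ} (f : BoolFun n) (σ : Equiv.Perm (Fin n)) : BoolFun n :=
  fun x => f (fun i => x (σ i))

/-- `f` and `g` are `ε`-close: they differ on at most an `ε` fraction of the inputs. -/
def BoolFun.IsClose {n : ℕ} (ε : ℝ) (f g : BoolFun n) : Prop :=
  ((Finset.univ.filter (fun x => f x ≠ g x)).card : ℝ) / (2 : ℝ) ^ n ≤ ε

/-- The set of `k`-juntas of `n` variables: the functions that depend on at most `k` of
their variables. -/
def kJuntas (n k : ℕ) : Set (BoolFun n) :=
  {f | ∃ J : Finset (Fin n), J.card ≤ k ∧ DependsOn f (J : Set (Fin n))}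

/-- A deterministic non-adaptive algorithm with `q` queries to a Boolean function of `n`
variables: the queried points are fixed in advance, independently of the answers, and the
output is a function of the `q` answers. -/
structure NonadaptiveAlgorithm (n q : ℕ) where
  query : Fin q → (Fin n → ZMod 2)
  output : (Fin q → ZMod 2) → ZMod 2

/-- The output of a non-adaptive algorithm when it is run with oracle access to `g`. -/
def NonadaptiveAlgorithm.run {n q : ℕ} (A : NonadaptiveAlgorithm n q) (g : BoolFun n) : ZMod 2 :=
  A.output (fun i => g (A.query i))

/-- `f` is locally correctable from noise rate `ε` using `q` non-adaptive queries: there is a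
randomized non-adaptive algorithm (for each point `x` that is to be corrected, a probability
distribution on the deterministic non-adaptive algorithms with `q` queries), which may depend
on `f`, but on neither `σ` nor `g`, such that for each `g` that is `ε`-close to an isomorphic
copy `f_σ` of `f` and each point `x`, the output of the algorithm on input `x`, when run with
oracle access to `g`, is `f_σ(x)` with probability at least `2/3`. -/
def NonadaptivelyLocallyCorrectable {n : ℕ} (f : BoolFun n) (q : ℕ) (ε : ℝ) : Prop :=
  ∃ A : (Fin n → ZMod 2) → PMF (NonadaptiveAlgorithm n q),
    ∀ (σ : Equiv.Perm (Fin n)) (g : BoolFun n), BoolFun.IsClose ε g (f.iso σ) →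
      ∀ x : Fin n → ZMod 2,
        (2 / 3 : ENNReal) ≤ (A x).toOuterMeasure {a | a.run g = f.iso σ x}

/-! To correct at `x`, query all of a random affine subspace `x + span u` with `2 ^ ℓ` points. On it
`f_σ` equals the core `h` of the junta composed with an affine map `𝔽₂^ℓ → 𝔽₂^k` whose base point is
the restriction of `x` to the relevant variables. The decoder searches all affine maps for one that
nearly matches the answers, so it needs neither `σ` nor the relevant variables.

This succeeds when `SeparatesAffineMaps` holds. A random `h` has that property: for a fixed pair of
maps the failure probability is at most `2 ^ (-3 * 2 ^ r)`, where `ℓ = r + 6`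
(`card_not_separating_pair_le`), against `2 ^ (2 * k * (r + 7))` pairs. The values of `h` at the
compared points are not disjoint pairs of bits; a cut of the comparison graph makes a quarter of the
differences independent (`sum_pow_card_ne_le`).

Finally, a separating core depends on all its variables, so distinct pairs of variable set and
separating core give distinct juntas, and the estimate for cores passes to juntas. -/

/-! ### Differences of a random function along a digraph -/

/-- All fibres of `φ` have the same size: the image of a uniform element is uniform. -/
theorem card_filter_comp_mul_card {G H : Type*} [AddGroup G] [AddGroup H] [Fintype G] [Fintype H]
    [DecidableEq H] (φ : G →+ H) (hφ : Function.Surjective φ) (p : H → Prop) [DecidablePred p] :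
    (Finset.univ.filter fun g => p (φ g)).card * Fintype.card H =
      (Finset.univ.filter p).card * Fintype.card G := by
  have key : ∀ s : Finset H, (Finset.univ.filter fun g => φ g ∈ s).card =
      s.card * (Finset.univ.filter fun g => φ g = 0).card := by
    intro s
    rw [Finset.card_eq_sum_card_fiberwise (f := φ) (t := s) (fun g hg => by simpa using hg)]
    rw [Finset.sum_const_nat]
    intro y hy
    rw [Finset.filter_filter]
    rw [← AddMonoidHom.card_fiber_eq_of_mem_range φ (hφ y) (hφ 0)]
    congr 1
    ext g
    simp only [Finset.mem_filter, Finset.mem_univ, true_and]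
    exact ⟨fun h => h.2, fun h => ⟨h ▸ hy, h⟩⟩
  have h1 := key (Finset.univ.filter p)
  have h2 := key Finset.univ
  simp only [Finset.mem_filter, Finset.mem_univ, true_and, Finset.filter_true,
    Finset.card_univ] at h1 h2
  rw [h1, h2]
  ring

theorem card_filter_eq_one_and_eq_zero {X : Type*} [Fintype X] [DecidableEq X] {p q : X}
    (h : p ≠ q) :
    4 * (Finset.univ.filter fun S : X → ZMod 2 => S p = 1 ∧ S q = 0).card =
      Fintype.card (X → ZMod 2) := by
  have key := card_filter_comp_mul_card
    ((Pi.evalAddMonoidHom (fun _ : X => ZMod 2) p).prod (Pi.evalAddMonoidHom _ q))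
    (fun c => ⟨Function.update (Function.update 0 p c.1) q c.2, by
      ext <;> simp [Function.update_of_ne h]⟩) (fun c => c = (1, 0))
  simp only [AddMonoidHom.prod_apply, Pi.evalAddMonoidHom_apply, Prod.mk.injEq,
    Fintype.card_prod, ZMod.card, Finset.filter_eq', Finset.mem_univ, if_true,
    Finset.card_singleton] at key
  omega

/-- Every loopless digraph has a cut that contains a quarter of its edges. -/
theorem exists_cut {α X : Type*} [Fintype X] [DecidableEq X] (T : Finset α) (P Q : α → X)
    (h : ∀ a ∈ T, P a ≠ Q a) :
    ∃ S : X → ZMod 2, T.card ≤ 4 * (T.filter fun a => S (P a) = 1 ∧ S (Q a) = 0).card := by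
  by_contra! hlt
  have h1 : ∑ S : X → ZMod 2, 4 * (T.filter fun a => S (P a) = 1 ∧ S (Q a) = 0).card <
      ∑ _S : X → ZMod 2, T.card :=
    Finset.sum_lt_sum_of_nonempty ⟨0, Finset.mem_univ _⟩ (fun S _ => hlt S)
  have h2 : ∑ S : X → ZMod 2, 4 * (T.filter fun a => S (P a) = 1 ∧ S (Q a) = 0).card =
      ∑ _S : X → ZMod 2, T.card := by
    -- A uniformly random `S` cuts each edge in the right direction with probability `1/4`.
    rw [← Finset.mul_sum]
    simp only [Finset.card_filter]
    rw [Finset.sum_comm, Finset.mul_sum]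
    simp only [← Finset.card_filter]
    rw [Finset.sum_congr rfl fun a ha => card_filter_eq_one_and_eq_zero (h a ha)]
    simp [mul_comm]
  omega

/-- The expectation factors over coordinates; each one in `U` contributes `(1 + 1/4) / 2 = 5/8`. -/
theorem sum_pow_card_support {X : Type*} [Fintype X] [DecidableEq X] (U : Finset X) :
    ∑ h : X → ZMod 2, (1 / 4 : ℝ) ^ (U.filter fun x => h x ≠ 0).card =
      (5 / 8) ^ U.card * 2 ^ Fintype.card X := by
  have h1 : ∀ h : X → ZMod 2, (1 / 4 : ℝ) ^ (U.filter fun x => h x ≠ 0).card =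
      ∏ x, if x ∈ U ∧ h x ≠ 0 then (1 / 4 : ℝ) else 1 := by
    intro h
    rw [← Finset.prod_filter, Finset.prod_const]
    congr 2
    ext x
    simp
  simp only [h1]
  have h2 := Finset.prod_univ_sum (fun _ : X => (Finset.univ : Finset (ZMod 2)))
    (fun x c => if x ∈ U ∧ c ≠ 0 then (1 / 4 : ℝ) else 1)
  rw [Fintype.piFinset_univ] at h2
  rw [← h2]
  have h3 : ∀ x, ∑ c : ZMod 2, (if x ∈ U ∧ c ≠ 0 then (1 / 4 : ℝ) else 1) =
      (if x ∈ U then (5 / 8) else 1) * 2 := by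
    intro x
    rw [show (Finset.univ : Finset (ZMod 2)) = {0, 1} from rfl, Finset.sum_pair (by decide)]
    by_cases hx : x ∈ U <;> simp [hx] <;> norm_num
  simp only [h3]
  rw [Finset.prod_mul_distrib, ← Finset.prod_filter, Finset.prod_const, Finset.prod_const,
    Finset.filter_mem_eq_inter, Finset.univ_inter, Finset.card_univ]

/-- If the values of a uniformly random Boolean function are compared along the edges of a
loopless digraph with out-degrees at most `1`, it is unlikely that few edges see a difference. -/
theorem sum_pow_card_ne_le {α X : Type*} [Fintype X] [DecidableEq X] (T : Finset α) (P Q : α → X)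
    (hP : Set.InjOn P T) (h : ∀ a ∈ T, P a ≠ Q a) {N : ℕ} (hN : 4 * N ≤ T.card) :
    ∑ f : X → ZMod 2, (1 / 4 : ℝ) ^ (T.filter fun a => f (P a) ≠ f (Q a)).card ≤
      (5 / 8) ^ N * 2 ^ Fintype.card X := by
  classical
  obtain ⟨S, hS⟩ := exists_cut T P Q h
  set T' := T.filter fun a => S (P a) = 1 ∧ S (Q a) = 0 with hT'
  have hP' : Set.InjOn P T' := hP.mono (by simp [hT', Set.subset_def]; tauto)
  set U := T'.image P with hU
  have hUc : U.card = T'.card := Finset.card_image_of_injOn hP'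
  have hQ : ∀ a ∈ T', Q a ∉ U := by
    intro a ha hmem
    obtain ⟨b, hb, hab⟩ := Finset.mem_image.1 hmem
    have h1 := (Finset.mem_filter.1 ha).2.2
    have h2 := (Finset.mem_filter.1 hb).2.1
    rw [← hab, h2] at h1
    exact one_ne_zero h1
  have hex : ∀ x, ∃ y, x ∈ U → ∃ a ∈ T', P a = x ∧ Q a = y := by
    intro x
    by_cases hx : x ∈ U
    · obtain ⟨a, ha, hax⟩ := Finset.mem_image.1 hx
      exact ⟨Q a, fun _ => ⟨a, ha, hax, rfl⟩⟩
    · exact ⟨x, fun hx' => absurd hx' hx⟩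
  choose ψ hψ using hex
  have hψP : ∀ a ∈ T', ψ (P a) = Q a := by
    intro a ha
    obtain ⟨b, hb, hba, hbQ⟩ := hψ (P a) (Finset.mem_image_of_mem P ha)
    rw [← hbQ, hP' hb ha hba]
  have hψU : ∀ x ∈ U, ψ x ∉ U := by
    intro x hx
    obtain ⟨b, hb, -, hbQ⟩ := hψ x hx
    rw [← hbQ]
    exact hQ b hb
  -- Replaces the value at the tail of each cut edge by the difference along it. Heads lie outside
  -- `U`, so this is a bijection and the differences become independent uniform bits.
  let Φ : (X → ZMod 2) → (X → ZMod 2) := fun f x => if x ∈ U then f x + f (ψ x) else f x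
  have hΦ : Function.Involutive Φ := by
    intro f
    funext x
    by_cases hx : x ∈ U
    · simp only [Φ, hx, hψU x hx, if_true, if_false]
      rw [add_assoc, CharTwo.add_self_eq_zero, add_zero]
    · simp only [Φ, hx, if_false]
  calc ∑ f : X → ZMod 2, (1 / 4 : ℝ) ^ (T.filter fun a => f (P a) ≠ f (Q a)).card
      ≤ ∑ f : X → ZMod 2, (1 / 4 : ℝ) ^ (U.filter fun x => Φ f x ≠ 0).card := by
        refine Finset.sum_le_sum fun f _ => pow_le_pow_of_le_one (by norm_num) (by norm_num) ?_
        calc (U.filter fun x => Φ f x ≠ 0).card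
            ≤ ((T.filter fun a => f (P a) ≠ f (Q a)).image P).card := by
              refine Finset.card_le_card fun x hx => ?_
              obtain ⟨hx, hne⟩ := Finset.mem_filter.1 hx
              obtain ⟨a, ha, rfl⟩ := Finset.mem_image.1 hx
              refine Finset.mem_image_of_mem P (Finset.mem_filter.2 ⟨(Finset.mem_filter.1 ha).1, ?_⟩)
              intro heq
              apply hne
              simp only [Φ, hx, if_true, hψP a ha, heq, CharTwo.add_self_eq_zero]
          _ ≤ _ := Finset.card_image_le
    _ = ∑ f : X → ZMod 2, (1 / 4 : ℝ) ^ (U.filter fun x => f x ≠ 0).card :=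
        Equiv.sum_comp hΦ.toPerm fun f => (1 / 4 : ℝ) ^ (U.filter fun x => f x ≠ 0).card
    _ = (5 / 8) ^ U.card * 2 ^ Fintype.card X := sum_pow_card_support U
    _ ≤ _ := by
        refine mul_le_mul_of_nonneg_right ?_ (by positivity)
        exact pow_le_pow_of_le_one (by norm_num) (by norm_num) (by omega)

/-! ### Random functions separate affine maps -/

/-- `h` separates affine maps: along any injective affine map `𝔽₂^ℓ → 𝔽₂^ι` the restriction of `h`
is far from the restriction of `h` along any other affine map. -/
def SeparatesAffineMaps {ι : Type*} (ℓ : ℕ) (h : (ι → ZMod 2) → ZMod 2) : Prop :=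
  ∀ c c' : (Fin ℓ → ι → ZMod 2) × (ι → ZMod 2),
    Function.Injective (Fintype.linearCombination (ZMod 2) c.1) → c ≠ c' →
      2 ^ ℓ < 64 * (Finset.univ.filter fun a : Fin ℓ → ZMod 2 =>
        h (c.2 + Fintype.linearCombination (ZMod 2) c.1 a) ≠
          h (c'.2 + Fintype.linearCombination (ZMod 2) c'.1 a)).card

theorem two_mul_card_linearMap_eq_le {ι : Type*} [Fintype ι] [DecidableEq ι] {ℓ : ℕ}
    (φ : (Fin ℓ → ZMod 2) →ₗ[ZMod 2] (ι → ZMod 2)) (hφ : φ ≠ 0) (d : ι → ZMod 2) :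
    2 * (Finset.univ.filter fun a => φ a = d).card ≤ 2 ^ ℓ := by
  obtain ⟨v, hv⟩ : ∃ v, φ v ≠ 0 := by
    by_contra! h
    exact hφ (LinearMap.ext h)
  have h1 : (Finset.univ.filter fun a => φ a = d).card ≤
      (Finset.univ.filter fun a => φ a ≠ d).card := by
    -- Translation by a vector outside the kernel moves the fibre off itself.
    refine Finset.card_le_card_of_injOn (fun a => a + v) (fun a ha => ?_)
      (fun a _ b _ hab => add_right_cancel hab)
    simp only [Finset.coe_filter, Finset.mem_univ, true_and, Set.mem_ofPred_eq, map_add] at ha ⊢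
    rw [ha]
    simpa using hv
  have h2 := Finset.card_filter_add_card_filter_not (s := (Finset.univ : Finset (Fin ℓ → ZMod 2)))
    (fun a => φ a = d)
  simp only [ne_eq] at h1
  simp only [Finset.card_univ, Fintype.card_pi, ZMod.card, Finset.prod_const, Fintype.card_fin] at h2
  omega

theorem two_mul_card_affine_ne {ι : Type*} [Fintype ι] [DecidableEq ι] {ℓ : ℕ}
    {c c' : (Fin ℓ → ι → ZMod 2) × (ι → ZMod 2)} (h : c ≠ c') :
    2 ^ ℓ ≤ 2 * (Finset.univ.filter fun a : Fin ℓ → ZMod 2 =>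
      c.2 + Fintype.linearCombination (ZMod 2) c.1 a ≠
        c'.2 + Fintype.linearCombination (ZMod 2) c'.1 a).card := by
  have h2 := Finset.card_filter_add_card_filter_not (s := (Finset.univ : Finset (Fin ℓ → ZMod 2)))
    (fun a => c.2 + Fintype.linearCombination (ZMod 2) c.1 a =
        c'.2 + Fintype.linearCombination (ZMod 2) c'.1 a)
  simp only [Finset.card_univ, Fintype.card_pi, ZMod.card, Finset.prod_const, Fintype.card_fin] at h2
  suffices 2 * (Finset.univ.filter fun a : Fin ℓ → ZMod 2 =>
      c.2 + Fintype.linearCombination (ZMod 2) c.1 a =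
        c'.2 + Fintype.linearCombination (ZMod 2) c'.1 a).card ≤ 2 ^ ℓ by
    simp only [ne_eq]
    omega
  by_cases h1 : c.1 = c'.1
  · have : c.2 ≠ c'.2 := fun h2 => h (Prod.ext h1 h2)
    simp [h1, this]
  · have hne : Fintype.linearCombination (ZMod 2) c.1 - Fintype.linearCombination (ZMod 2) c'.1 ≠ 0 := by
      intro h0
      apply h1
      funext i
      have := LinearMap.congr_fun h0 (Pi.single i 1)
      simpa [Fintype.linearCombination_apply_single, sub_eq_zero] using this
    refine le_of_eq_of_le ?_ (two_mul_card_linearMap_eq_le _ hne (c'.2 - c.2))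
    congr 2
    ext a
    simp only [Finset.mem_filter, Finset.mem_univ, true_and, LinearMap.sub_apply]
    rw [sub_eq_sub_iff_add_eq_add, add_comm, add_comm c'.2]

/-- An exponential Markov bound with weight `1/4` per difference. Injectivity of the first map is
what bounds the out-degrees by `1`. -/
theorem card_not_separating_pair_le {ι : Type*} [Fintype ι] [DecidableEq ι] {r : ℕ}
    {c c' : (Fin (r + 6) → ι → ZMod 2) × (ι → ZMod 2)} (h : c ≠ c')
    (hc : Function.Injective (Fintype.linearCombination (ZMod 2) c.1)) :
    (Finset.univ.filter fun f : (ι → ZMod 2) → ZMod 2 =>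
      64 * (Finset.univ.filter fun a : Fin (r + 6) → ZMod 2 =>
        f (c.2 + Fintype.linearCombination (ZMod 2) c.1 a) ≠
          f (c'.2 + Fintype.linearCombination (ZMod 2) c'.1 a)).card ≤ 2 ^ (r + 6)).card *
        2 ^ (3 * 2 ^ r) ≤ 2 ^ Fintype.card (ι → ZMod 2) := by
  set P := fun a => c.2 + Fintype.linearCombination (ZMod 2) c.1 a with hPdef
  set Q := fun a => c'.2 + Fintype.linearCombination (ZMod 2) c'.1 a with hQdef
  have hT := two_mul_card_affine_ne h
  set T := Finset.univ.filter fun a => P a ≠ Q a with hTdef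
  have hpow : 2 ^ (r + 6) = 64 * 2 ^ r := by ring
  -- The maps differ at half of the `64 * 2 ^ r` points, and a cut keeps a quarter of those.
  have hsum := sum_pow_card_ne_le T P Q
    (fun a _ b _ hab => hc (add_left_cancel hab)) (fun a ha => (Finset.mem_filter.1 ha).2)
    (N := 8 * 2 ^ r) (by rw [hpow] at hT; change _ ≤ 2 * T.card at hT; omega)
  set F := Finset.univ.filter fun f : (ι → ZMod 2) → ZMod 2 =>
      64 * (Finset.univ.filter fun a => f (P a) ≠ f (Q a)).card ≤ 2 ^ (r + 6) with hF
  have h1 : (F.card : ℝ) * (1 / 4) ^ (2 ^ r) ≤ (5 / 8) ^ (8 * 2 ^ r) *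
      2 ^ Fintype.card (ι → ZMod 2) := by
    refine le_trans ?_ hsum
    rw [← nsmul_eq_mul]
    refine le_trans (Finset.card_nsmul_le_sum F _ _ fun f hf => ?_)
      (Finset.sum_le_sum_of_subset_of_nonneg (Finset.subset_univ F) fun _ _ _ => by positivity)
    refine pow_le_pow_of_le_one (by norm_num) (by norm_num) ?_
    have h2 := (Finset.mem_filter.1 hf).2
    have h3 : (T.filter fun a => f (P a) ≠ f (Q a)).card ≤
        (Finset.univ.filter fun a => f (P a) ≠ f (Q a)).card :=
      Finset.card_le_card (Finset.filter_subset_filter _ (Finset.subset_univ _))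
    omega
  -- Since `(5/8)^8 < 1/32`; the factor `1/4` pays for the Markov threshold `2 ^ r`.
  have h4 : (5 / 8 : ℝ) ^ (8 * 2 ^ r) ≤ (1 / 4) ^ (2 ^ r) * (1 / 8) ^ (2 ^ r) := by
    rw [pow_mul, ← mul_pow]
    exact pow_le_pow_left₀ (by norm_num) (by norm_num) _
  have h5 : (F.card : ℝ) ≤ (1 / 8) ^ (2 ^ r) * 2 ^ Fintype.card (ι → ZMod 2) := by
    have h6 : (0 : ℝ) < (1 / 4) ^ (2 ^ r) := by positivity
    refine le_of_mul_le_mul_right ?_ h6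
    calc _ ≤ _ := h1
      _ ≤ (1 / 4) ^ (2 ^ r) * (1 / 8) ^ (2 ^ r) * 2 ^ Fintype.card (ι → ZMod 2) := by gcongr
      _ = _ := by ring
  have h7 : (F.card : ℝ) * 2 ^ (3 * 2 ^ r) ≤ 2 ^ Fintype.card (ι → ZMod 2) := by
    calc (F.card : ℝ) * 2 ^ (3 * 2 ^ r)
        ≤ (1 / 8) ^ (2 ^ r) * 2 ^ Fintype.card (ι → ZMod 2) * 2 ^ (3 * 2 ^ r) := by gcongr
      _ = ((1 / 8) ^ (2 ^ r) * 8 ^ (2 ^ r)) * 2 ^ Fintype.card (ι → ZMod 2) := by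
        rw [pow_mul]; norm_num; ring
      _ = _ := by rw [← mul_pow]; norm_num
  exact_mod_cast h7

open Classical in
-- Union bound over pairs of affine maps; the `+ 1` in `hr` leaves the spare factor `2 ^
-- Fintype.card ι`.
theorem card_not_separatesAffineMaps_le {ι : Type*} [Fintype ι] [DecidableEq ι] {r : ℕ}
    (hr : Fintype.card ι * (2 * (r + 7) + 1) ≤ 3 * 2 ^ r) :
    (Finset.univ.filter fun h : (ι → ZMod 2) → ZMod 2 => ¬ SeparatesAffineMaps (r + 6) h).card *
      2 ^ Fintype.card ι ≤ 2 ^ 2 ^ Fintype.card ι := by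
  set k := Fintype.card ι with hk
  set C := (Fin (r + 6) → ι → ZMod 2) × (ι → ZMod 2)
  have hC : Fintype.card C = 2 ^ (k * (r + 7)) := by
    simp only [C, Fintype.card_prod, Fintype.card_pi, ZMod.card, Finset.prod_const,
      Finset.card_univ, Fintype.card_fin, ← hk, ← pow_mul, ← pow_add]
    congr 1
  let E : C × C → Finset ((ι → ZMod 2) → ZMod 2) := fun p =>
    if p.1 ≠ p.2 ∧ Function.Injective (Fintype.linearCombination (ZMod 2) p.1.1) then
      Finset.univ.filter fun f : (ι → ZMod 2) → ZMod 2 =>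
        64 * (Finset.univ.filter fun a : Fin (r + 6) → ZMod 2 =>
          f (p.1.2 + Fintype.linearCombination (ZMod 2) p.1.1 a) ≠
            f (p.2.2 + Fintype.linearCombination (ZMod 2) p.2.1 a)).card ≤ 2 ^ (r + 6)
    else ∅
  have hE : ∀ p, (E p).card * 2 ^ (3 * 2 ^ r) ≤ 2 ^ 2 ^ k := by
    intro p
    by_cases hp : p.1 ≠ p.2 ∧ Function.Injective (Fintype.linearCombination (ZMod 2) p.1.1)
    · have := card_not_separating_pair_le hp.1 hp.2
      simp only [E, if_pos hp]
      convert this using 2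
      simp [hk]
    · simp [E, if_neg hp]
  have hsub : (Finset.univ.filter fun h : (ι → ZMod 2) → ZMod 2 =>
      ¬ SeparatesAffineMaps (r + 6) h) ⊆ Finset.univ.biUnion E := by
    intro h hh
    simp only [SeparatesAffineMaps, Finset.mem_filter, Finset.mem_univ, true_and, not_forall,
      not_lt] at hh
    obtain ⟨c, c', hinj, hne, hle⟩ := hh
    refine Finset.mem_biUnion.2 ⟨(c, c'), Finset.mem_univ _, ?_⟩
    simp only [E, if_pos (And.intro hne hinj)]
    exact Finset.mem_filter.2 ⟨Finset.mem_univ _, hle⟩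
  have h1 := (Finset.card_le_card hsub).trans Finset.card_biUnion_le
  have h2 : (∑ p, (E p).card) * 2 ^ (3 * 2 ^ r) ≤ 2 ^ (k * (2 * (r + 7))) * 2 ^ 2 ^ k := by
    rw [Finset.sum_mul]
    refine (Finset.sum_le_card_nsmul _ _ _ fun p _ => hE p).trans (le_of_eq ?_)
    rw [Finset.card_univ, Fintype.card_prod, hC, smul_eq_mul, ← pow_add]
    congr 2
    ring
  refine Nat.le_of_mul_le_mul_right (c := 2 ^ (k * (2 * (r + 7)))) ?_ (by positivity)
  calc _ = (Finset.univ.filter fun h : (ι → ZMod 2) → ZMod 2 =>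
        ¬ SeparatesAffineMaps (r + 6) h).card * 2 ^ (k * (2 * (r + 7) + 1)) := by
        rw [mul_assoc, ← pow_add]; congr 2; ring
    _ ≤ (∑ p, (E p).card) * 2 ^ (3 * 2 ^ r) :=
        Nat.mul_le_mul h1 (Nat.pow_le_pow_right (by norm_num) hr)
    _ ≤ _ := by rw [mul_comm (2 ^ 2 ^ k)]; exact h2

/-! ### Random query subspaces -/

/-- Evaluation of a linear combination with fixed coefficients `a`, followed by a linear map. -/
def evalLinearCombination {ℓ : ℕ} {W W' : Type*} [AddCommGroup W] [Module (ZMod 2) W]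
    [AddCommGroup W'] [Module (ZMod 2) W'] (r : W →ₗ[ZMod 2] W') (a : Fin ℓ → ZMod 2) :
    (Fin ℓ → W) →+ W' where
  toFun u := r (Fintype.linearCombination (ZMod 2) u a)
  map_zero' := by simp [Fintype.linearCombination_apply]
  map_add' u v := by
    simp [Fintype.linearCombination_apply, Finset.sum_add_distrib]

theorem evalLinearCombination_surjective {ℓ : ℕ} {W W' : Type*} [AddCommGroup W]
    [Module (ZMod 2) W] [AddCommGroup W'] [Module (ZMod 2) W'] (r : W →ₗ[ZMod 2] W')
    (hr : Function.Surjective r) {a : Fin ℓ → ZMod 2} (ha : a ≠ 0) :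
    Function.Surjective (evalLinearCombination r a) := by
  intro w
  obtain ⟨v, rfl⟩ := hr w
  obtain ⟨i, hi⟩ := Function.ne_iff.1 ha
  refine ⟨Pi.single i ((a i)⁻¹ • v), ?_⟩
  change r (Fintype.linearCombination (ZMod 2) (Pi.single i ((a i)⁻¹ • v)) a) = _
  rw [Fintype.linearCombination_apply, Finset.sum_eq_single i]
  · rw [Pi.single_eq_same, smul_smul, mul_inv_cancel₀ hi, one_smul]
  · intro j _ hj
    rw [Pi.single_eq_of_ne hj, smul_zero]
  · simp

theorem map_linearCombination {ℓ : ℕ} {W W' : Type*} [AddCommGroup W] [Module (ZMod 2) W]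
    [AddCommGroup W'] [Module (ZMod 2) W'] (r : W →ₗ[ZMod 2] W') (u : Fin ℓ → W)
    (a : Fin ℓ → ZMod 2) : Fintype.linearCombination (ZMod 2) (fun i => r (u i)) a =
      r (Fintype.linearCombination (ZMod 2) u a) := by
  simp [Fintype.linearCombination_apply, map_sum]

open Classical in
-- For each `a ≠ 0` the combination is uniform, hence zero with probability `2 ^ (-Fintype.card ι)`;
-- sum over `a`.
theorem card_not_injective_linearCombination_le {ι κ : Type*} [Fintype ι] [Fintype κ]
    [DecidableEq κ] (ℓ : ℕ)
    (r : (κ → ZMod 2) →ₗ[ZMod 2] (ι → ZMod 2)) (hr : Function.Surjective r) :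
    (Finset.univ.filter fun u : Fin ℓ → κ → ZMod 2 =>
      ¬ Function.Injective (Fintype.linearCombination (ZMod 2) fun i => r (u i))).card *
        2 ^ Fintype.card ι ≤ 2 ^ ℓ * Fintype.card (Fin ℓ → κ → ZMod 2) := by
  have hsub : (Finset.univ.filter fun u : Fin ℓ → κ → ZMod 2 =>
      ¬ Function.Injective (Fintype.linearCombination (ZMod 2) fun i => r (u i))) ⊆
      (Finset.univ.filter fun a : Fin ℓ → ZMod 2 => a ≠ 0).biUnion fun a =>
        Finset.univ.filter fun u => evalLinearCombination r a u = 0 := by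
    intro u hu
    have hu := (Finset.mem_filter.1 hu).2
    rw [injective_iff_map_eq_zero] at hu
    push Not at hu
    obtain ⟨a, ha, ha0⟩ := hu
    rw [map_linearCombination] at ha
    exact Finset.mem_biUnion.2 ⟨a, Finset.mem_filter.2 ⟨Finset.mem_univ _, ha0⟩,
      Finset.mem_filter.2 ⟨Finset.mem_univ _, ha⟩⟩
  refine (Nat.mul_le_mul_right _ ((Finset.card_le_card hsub).trans
    Finset.card_biUnion_le)).trans ?_
  rw [Finset.sum_mul]
  have h1 : ∀ a ∈ Finset.univ.filter fun a : Fin ℓ → ZMod 2 => a ≠ 0,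
      (Finset.univ.filter fun u => evalLinearCombination r a u = 0).card * 2 ^ Fintype.card ι ≤
        Fintype.card (Fin ℓ → κ → ZMod 2) := by
    intro a ha
    have := card_filter_comp_mul_card (evalLinearCombination r a)
      (evalLinearCombination_surjective r hr (Finset.mem_filter.1 ha).2) (fun w => w = 0)
    rw [Finset.filter_eq', if_pos (Finset.mem_univ _), Finset.card_singleton, one_mul] at this
    rw [← this]
    simp
  refine (Finset.sum_le_card_nsmul _ _ _ h1).trans ?_
  rw [smul_eq_mul]
  refine Nat.mul_le_mul_right _ ((Finset.card_filter_le _ _).trans (le_of_eq ?_))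
  simp

/-- A Markov bound for the number of queries on a random subspace that hit an exceptional set. -/
theorem card_many_errors_le {ℓ n : ℕ} (x : Fin n → ZMod 2) (E : (Fin n → ZMod 2) → Prop)
    [DecidablePred E]
    (hE : ((Finset.univ.filter E).card : ℝ) / 2 ^ n ≤ 0.001) :
    ((Finset.univ.filter fun u : Fin ℓ → Fin n → ZMod 2 =>
      2 ^ ℓ < 256 * (Finset.univ.filter fun a : Fin ℓ → ZMod 2 =>
        a ≠ 0 ∧ E (x + Fintype.linearCombination (ZMod 2) u a)).card).card : ℝ) ≤
      0.256 * Fintype.card (Fin ℓ → Fin n → ZMod 2) := by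
  set Ω := Fin ℓ → Fin n → ZMod 2
  set cnt : Ω → ℕ := fun u => (Finset.univ.filter fun a : Fin ℓ → ZMod 2 =>
        a ≠ 0 ∧ E (x + Fintype.linearCombination (ZMod 2) u a)).card with hcnt
  set B := Finset.univ.filter fun u : Ω => 2 ^ ℓ < 256 * cnt u with hB
  have h1 : B.card * 2 ^ ℓ ≤ 256 * ∑ u, cnt u := by
    rw [Finset.mul_sum, ← smul_eq_mul]
    refine (Finset.card_nsmul_le_sum B (fun u => 256 * cnt u) _ fun u hu =>
      (Finset.mem_filter.1 hu).2.le).trans ?_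
    exact Finset.sum_le_sum_of_subset (Finset.subset_univ B)
  -- Linearity of expectation. Only `a ≠ 0` gives a uniform query point; `a = 0` always queries `x`.
  have h2 : ∑ u, cnt u = ∑ a ∈ Finset.univ.filter fun a : Fin ℓ → ZMod 2 => a ≠ 0,
      (Finset.univ.filter fun u : Ω => E (x + Fintype.linearCombination (ZMod 2) u a)).card := by
    simp only [hcnt, ← Finset.filter_filter]
    simp only [Finset.card_filter _ (Finset.filter _ _)]
    rw [Finset.sum_comm]
    simp only [Finset.card_filter]
  have h3 : ∀ a ∈ Finset.univ.filter fun a : Fin ℓ → ZMod 2 => a ≠ 0,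
      ((Finset.univ.filter fun u : Ω =>
        E (x + Fintype.linearCombination (ZMod 2) u a)).card : ℝ) ≤ 0.001 * Fintype.card Ω := by
    intro a ha
    have h4 := card_filter_comp_mul_card (evalLinearCombination LinearMap.id a)
      (evalLinearCombination_surjective LinearMap.id Function.surjective_id
        (Finset.mem_filter.1 ha).2) (fun w : Fin n → ZMod 2 => E (x + w))
    have h5 : (Finset.univ.filter fun w => E (x + w)).card = (Finset.univ.filter E).card := by
      refine Finset.card_bij (fun w _ => x + w) (by simp) (by simp) ?_
      intro y hy
      exact ⟨y - x, by simpa using hy, by simp⟩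
    rw [h5] at h4
    simp only [Fintype.card_pi, ZMod.card, Finset.prod_const, Finset.card_univ,
      Fintype.card_fin] at h4
    have h6 : ((Finset.univ.filter fun u : Ω =>
        E (x + Fintype.linearCombination (ZMod 2) u a)).card : ℝ) * 2 ^ n =
        (Finset.univ.filter E).card * Fintype.card Ω := by
      have h7 : Fintype.card Ω = (2 ^ n) ^ ℓ := by simp [Ω]
      rw [h7]
      exact_mod_cast h4
    have hpos : (0 : ℝ) < 2 ^ n := by positivity
    rw [div_le_iff₀ hpos] at hE
    refine le_of_mul_le_mul_right ?_ hpos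
    rw [h6]
    calc _ ≤ (0.001 * 2 ^ n : ℝ) * Fintype.card Ω := by gcongr
      _ = _ := by ring
  have h8 : ((∑ u, cnt u : ℕ) : ℝ) ≤ 2 ^ ℓ * (0.001 * Fintype.card Ω) := by
    rw [h2, Nat.cast_sum]
    refine (Finset.sum_le_card_nsmul _ _ _ h3).trans ?_
    rw [nsmul_eq_mul]
    refine mul_le_mul_of_nonneg_right ?_ (by positivity)
    refine (Nat.cast_le.2 (Finset.card_filter_le _ _)).trans (le_of_eq ?_)
    simp
  have h9 : (B.card : ℝ) * 2 ^ ℓ ≤ 256 * ((∑ u, cnt u : ℕ) : ℝ) := by exact_mod_cast h1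
  have hpos : (0 : ℝ) < 2 ^ ℓ := by positivity
  refine le_of_mul_le_mul_right (h9.trans ?_) hpos
  linarith

/-! ### Decoding and the local corrector -/

open Classical in
/-- Decoding: find an affine map along which `h` nearly matches the answers, and return the value
of `h` at the base point. -/
noncomputable def decodeAffine {ι : Type*} (ℓ : ℕ) (h : (ι → ZMod 2) → ZMod 2)
    (ans : (Fin ℓ → ZMod 2) → ZMod 2) : ZMod 2 :=
  if H : ∃ c : (Fin ℓ → ι → ZMod 2) × (ι → ZMod 2),
      128 * (Finset.univ.filter fun a =>
        h (c.2 + Fintype.linearCombination (ZMod 2) c.1 a) ≠ ans a).card ≤ 2 ^ ℓ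
  then h H.choose.2 else 0

/-- By the triangle inequality, two maps within `1/128` of the answers are within `1/64` of each
other. Only the true map must be injective, so the search can range over all maps. -/
theorem decodeAffine_eq {ι : Type*} {ℓ : ℕ} {h : (ι → ZMod 2) → ZMod 2}
    (hs : SeparatesAffineMaps ℓ h) (ans : (Fin ℓ → ZMod 2) → ZMod 2)
    (c : (Fin ℓ → ι → ZMod 2) × (ι → ZMod 2))
    (hc : Function.Injective (Fintype.linearCombination (ZMod 2) c.1))
    (hans : 128 * (Finset.univ.filter fun a =>
        h (c.2 + Fintype.linearCombination (ZMod 2) c.1 a) ≠ ans a).card ≤ 2 ^ ℓ) :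
    decodeAffine ℓ h ans = h c.2 := by
  have H : ∃ c : (Fin ℓ → ι → ZMod 2) × (ι → ZMod 2),
      128 * (Finset.univ.filter fun a =>
        h (c.2 + Fintype.linearCombination (ZMod 2) c.1 a) ≠ ans a).card ≤ 2 ^ ℓ := ⟨c, hans⟩
  rw [decodeAffine, dif_pos H]
  have hspec := H.choose_spec
  set c' := H.choose
  by_cases hcc : c = c'
  · rw [hcc]
  exfalso
  have h1 := hs c c' hc hcc
  have h2 : (Finset.univ.filter fun a : Fin ℓ → ZMod 2 =>
        h (c.2 + Fintype.linearCombination (ZMod 2) c.1 a) ≠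
          h (c'.2 + Fintype.linearCombination (ZMod 2) c'.1 a)).card ≤
      (Finset.univ.filter fun a =>
        h (c.2 + Fintype.linearCombination (ZMod 2) c.1 a) ≠ ans a).card +
      (Finset.univ.filter fun a =>
        h (c'.2 + Fintype.linearCombination (ZMod 2) c'.1 a) ≠ ans a).card := by
    refine le_trans (Finset.card_le_card fun a ha => ?_) (Finset.card_union_le _ _)
    simp only [Finset.mem_filter, Finset.mem_univ, true_and, Finset.mem_union] at ha ⊢
    by_contra! hcon
    exact ha (hcon.1.trans hcon.2.symm)
  omega

/-- The algorithm that queries all points of the affine span of the `u i` through `x`. -/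
noncomputable def subspaceCorrector {ι : Type*} (ℓ n : ℕ) (h : (ι → ZMod 2) → ZMod 2)
    (x : Fin n → ZMod 2) (u : Fin ℓ → Fin n → ZMod 2) : NonadaptiveAlgorithm n (2 ^ ℓ) where
  query t := x + Fintype.linearCombination (ZMod 2) u
    ((Fintype.equivFinOfCardEq (α := Fin ℓ → ZMod 2) (by simp)).symm t)
  output ans := decodeAffine ℓ h fun a => ans (Fintype.equivFinOfCardEq (by simp) a)

theorem subspaceCorrector_run {ι : Type*} {ℓ n : ℕ} (h : (ι → ZMod 2) → ZMod 2)
    (x : Fin n → ZMod 2) (u : Fin ℓ → Fin n → ZMod 2) (g : BoolFun n) :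
    (subspaceCorrector ℓ n h x u).run g =
      decodeAffine ℓ h fun a => g (x + Fintype.linearCombination (ZMod 2) u a) := by
  simp [subspaceCorrector, NonadaptiveAlgorithm.run]

/-- Decoding fails only for a degenerate subspace or too many errors: probability at most `1/32 +
0.256 < 1/3`. -/
theorem SeparatesAffineMaps.locallyCorrectable {ι : Type*} [Fintype ι] {ℓ n : ℕ}
    {h : (ι → ZMod 2) → ZMod 2} (hs : SeparatesAffineMaps ℓ h) {e : ι → Fin n}
    (he : Function.Injective e) (hℓ : 8 ≤ ℓ) (hι : ℓ + 5 ≤ Fintype.card ι) :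
    NonadaptivelyLocallyCorrectable (fun x => h fun i => x (e i)) (2 ^ ℓ) 0.001 := by
  classical
  refine ⟨fun x => (PMF.uniformOfFintype (Fin ℓ → Fin n → ZMod 2)).map (subspaceCorrector ℓ n h x),
    fun σ g hg x => ?_⟩
  rw [PMF.toOuterMeasure_map_apply, PMF.toOuterMeasure_uniformOfFintype_apply]
  set Ω := Fin ℓ → Fin n → ZMod 2
  -- The permutation enters only through `r`, which the algorithm never uses.
  set r := LinearMap.funLeft (ZMod 2) (ZMod 2) fun i => σ (e i)
  have hr : Function.Surjective r :=
    LinearMap.funLeft_surjective_of_injective _ _ _ (σ.injective.comp he)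
  set f : BoolFun n := BoolFun.iso (fun x => h fun i => x (e i)) σ with hf
  have hfr : ∀ y, f y = h (r y) := fun y => rfl
  set B₁ := Finset.univ.filter fun u : Ω =>
      ¬ Function.Injective (Fintype.linearCombination (ZMod 2) fun i => r (u i))
  set B₂ := Finset.univ.filter fun u : Ω =>
      2 ^ ℓ < 256 * (Finset.univ.filter fun a : Fin ℓ → ZMod 2 =>
        a ≠ 0 ∧ g (x + Fintype.linearCombination (ZMod 2) u a) ≠
          f (x + Fintype.linearCombination (ZMod 2) u a)).card
  have hB₁ : 32 * B₁.card ≤ Fintype.card Ω := by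
    have h1 := card_not_injective_linearCombination_le ℓ r hr
    have h2 : 2 ^ ℓ * 32 ≤ 2 ^ Fintype.card ι := by
      rw [show (32 : ℕ) = 2 ^ 5 by norm_num, ← pow_add]
      exact Nat.pow_le_pow_right (by norm_num) hι
    refine Nat.le_of_mul_le_mul_left (c := 2 ^ ℓ) ?_ (by positivity)
    calc 2 ^ ℓ * (32 * B₁.card) = B₁.card * (2 ^ ℓ * 32) := by ring
      _ ≤ B₁.card * 2 ^ Fintype.card ι := Nat.mul_le_mul_left _ h2
      _ ≤ _ := h1
  have hB₂ : (B₂.card : ℝ) ≤ 0.256 * Fintype.card Ω :=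
    card_many_errors_le x (fun y => g y ≠ f y) hg
  have hgood : ∀ u, u ∉ B₁ → u ∉ B₂ → (subspaceCorrector ℓ n h x u).run g = f x := by
    intro u h1 h2
    simp only [B₁, B₂, Finset.mem_filter, Finset.mem_univ, true_and, not_not, not_lt] at h1 h2
    rw [subspaceCorrector_run, hfr]
    refine decodeAffine_eq hs _ (fun i => r (u i), r x) h1 ?_
    have h3 : (Finset.univ.filter fun a : Fin ℓ → ZMod 2 =>
        h (r x + Fintype.linearCombination (ZMod 2) (fun i => r (u i)) a) ≠
          g (x + Fintype.linearCombination (ZMod 2) u a)) ⊆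
        -- The noise may always hit `x` itself. This single error is at most `2 ^ ℓ / 256`, as `8 ≤
        -- ℓ`.
        insert 0 (Finset.univ.filter fun a : Fin ℓ → ZMod 2 =>
          a ≠ 0 ∧ g (x + Fintype.linearCombination (ZMod 2) u a) ≠
            f (x + Fintype.linearCombination (ZMod 2) u a)) := by
      intro a ha
      simp only [Finset.mem_filter, Finset.mem_univ, true_and, Finset.mem_insert] at ha ⊢
      rw [map_linearCombination, ← map_add, ← hfr] at ha
      by_cases ha0 : a = 0
      · exact Or.inl ha0
      · exact Or.inr ⟨ha0, ha.symm⟩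
    have h4 := (Finset.card_le_card h3).trans (Finset.card_insert_le _ _)
    have h5 : 2 ^ 8 ≤ 2 ^ ℓ := Nat.pow_le_pow_right (by norm_num) hℓ
    change 128 * (Finset.univ.filter fun a : Fin ℓ → ZMod 2 =>
        h (r x + Fintype.linearCombination (ZMod 2) (fun i => r (u i)) a) ≠
          g (x + Fintype.linearCombination (ZMod 2) u a)).card ≤ 2 ^ ℓ
    omega
  set S : Set Ω := subspaceCorrector ℓ n h x ⁻¹' {a | a.run g = f x}
  have hcard : Fintype.card Ω ≤ Fintype.card S + (B₁.card + B₂.card) := by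
    rw [← Set.toFinset_card, ← Finset.card_univ]
    refine le_trans (Finset.card_le_card fun u _ => ?_) ((Finset.card_union_le _ _).trans
      (Nat.add_le_add_left (Finset.card_union_le B₁ B₂) _))
    simp only [Finset.mem_union, Set.mem_toFinset]
    by_cases h1 : u ∈ B₁
    · exact Or.inr (Or.inl h1)
    by_cases h2 : u ∈ B₂
    · exact Or.inr (Or.inr h2)
    exact Or.inl (hgood u h1 h2)
  have hfin : 2 * Fintype.card Ω ≤ Fintype.card S * 3 := by
    have h1 : (32 : ℝ) * B₁.card ≤ Fintype.card Ω := by exact_mod_cast hB₁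
    have h2 : (Fintype.card Ω : ℝ) ≤ Fintype.card S + (B₁.card + B₂.card) := by
      exact_mod_cast hcard
    have h3 : (2 : ℝ) * Fintype.card Ω ≤ Fintype.card S * 3 := by linarith
    exact_mod_cast h3
  rw [ENNReal.le_div_iff_mul_le (by simp) (by simp), div_eq_mul_inv, mul_right_comm,
    ← div_eq_mul_inv, ENNReal.div_le_iff (by simp) (by simp)]
  exact_mod_cast hfin

/-! ### Counting juntas by their cores -/

theorem exists_injective_linearCombination {ι : Type*} [Fintype ι] {ℓ : ℕ}
    (hℓ : ℓ < Fintype.card ι) : ∃ B : Fin ℓ → ι → ZMod 2,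
      Function.Injective (Fintype.linearCombination (ZMod 2) B) := by
  classical
  by_contra! hcon
  have h1 := card_not_injective_linearCombination_le ℓ
    (LinearMap.id : (ι → ZMod 2) →ₗ[ZMod 2] (ι → ZMod 2)) Function.surjective_id
  simp only [LinearMap.id_apply] at h1
  rw [Finset.filter_true_of_mem fun u _ => hcon u, Finset.card_univ, mul_comm] at h1
  have h2 := Nat.le_of_mul_le_mul_right h1 Fintype.card_pos
  exact absurd h2 (not_le.2 (Nat.pow_lt_pow_right (by norm_num) hℓ))

/-- Otherwise two affine maps with equal linear part and base points `0` and `Pi.single i 1` would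
give the same restriction. -/
theorem SeparatesAffineMaps.exists_add_single_ne {ι : Type*} [Fintype ι] [DecidableEq ι] {ℓ : ℕ}
    {h : (ι → ZMod 2) → ZMod 2} (hs : SeparatesAffineMaps ℓ h) (hℓ : ℓ < Fintype.card ι) (i : ι) :
    ∃ y, h y ≠ h (y + Pi.single i 1) := by
  by_contra! hcon
  obtain ⟨B, hB⟩ := exists_injective_linearCombination hℓ
  have hne : ((B, 0) : (Fin ℓ → ι → ZMod 2) × (ι → ZMod 2)) ≠ (B, Pi.single i 1) := by
    intro heq
    have := congrFun (Prod.ext_iff.1 heq).2 i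
    simp at this
  have h1 := hs _ _ hB hne
  simp only [zero_add] at h1
  rw [Finset.filter_false_of_mem] at h1
  · simp at h1
  · intro a _
    rw [add_comm (Pi.single i 1), ← hcon]
    simp

/-- The function of `n` variables that applies `h` to the variables in `J`. -/
def juntaOn {n : ℕ} (J : Finset (Fin n)) (h : (J → ZMod 2) → ZMod 2) : BoolFun n :=
  fun x => h fun i => x i

theorem juntaOn_injective {n : ℕ} (J : Finset (Fin n)) : Function.Injective (juntaOn J) := by
  classical
  intro h h' heq
  funext y
  have := congrFun heq fun i => if hi : i ∈ J then y ⟨i, hi⟩ else 0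
  simpa [juntaOn] using this

theorem juntaOn_mem_kJuntas {n k : ℕ} {J : Finset (Fin n)} (hJ : J.card = k)
    (h : (J → ZMod 2) → ZMod 2) : juntaOn J h ∈ kJuntas n k :=
  ⟨J, hJ.le, fun _ _ hxy => congrArg h (funext fun i => hxy i i.2)⟩

theorem exists_eq_juntaOn {n k : ℕ} (hk : k ≤ n) {f : BoolFun n} (hf : f ∈ kJuntas n k) :
    ∃ J : Finset (Fin n), J.card = k ∧ ∃ h, f = juntaOn J h := by
  classical
  obtain ⟨J₀, hJ₀, hdep⟩ := hf
  obtain ⟨J, hsub, hJ⟩ := Finset.exists_superset_card_eq hJ₀ (by simpa using hk)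
  refine ⟨J, hJ, fun y => f fun i => if hi : i ∈ J then y ⟨i, hi⟩ else 0, ?_⟩
  funext x
  refine hdep fun i hi => ?_
  simp [hsub hi]

theorem SeparatesAffineMaps.subset_of_juntaOn_eq {n ℓ : ℕ} {J J' : Finset (Fin n)}
    {h : (J → ZMod 2) → ZMod 2} {h' : (J' → ZMod 2) → ZMod 2} (hs : SeparatesAffineMaps ℓ h)
    (hℓ : ℓ < J.card) (heq : juntaOn J h = juntaOn J' h') : J ⊆ J' := by
  intro i hi
  by_contra hi'
  obtain ⟨y, hy⟩ := hs.exists_add_single_ne (by simpa using hℓ) ⟨i, hi⟩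
  apply hy
  let x : Fin n → ZMod 2 := fun j => if hj : j ∈ J then y ⟨j, hj⟩ else 0
  have h1 : juntaOn J h x = h y := by simp [juntaOn, x]
  have h2 : juntaOn J h (x + Pi.single i 1) = h (y + Pi.single ⟨i, hi⟩ 1) := by
    refine congrArg h (funext fun j => ?_)
    simp [x, Pi.single_apply, Subtype.ext_iff]
  rw [← h1, ← h2, heq]
  refine congrArg h' (funext fun j => ?_)
  have : (j : Fin n) ≠ i := fun hji => hi' (hji ▸ j.2)
  simp [this]

/-- Overcounting is harmless for the bad juntas. The total is bounded below by good cores alone,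
which are at least half of all cores and are counted without repetition. -/
theorem two_pow_mul_ncard_not_correctable_le {n k r : ℕ} (hkn : k ≤ n) (hk : r + 11 ≤ k)
    (hr2 : 2 ≤ r) (hr : k * (2 * (r + 7) + 1) ≤ 3 * 2 ^ r) :
    2 ^ k * {f ∈ kJuntas n k |
      ¬ NonadaptivelyLocallyCorrectable f (2 ^ (r + 6)) 0.001}.ncard ≤
        2 * (kJuntas n k).ncard := by
  classical
  set 𝒥 := Finset.powersetCard k (Finset.univ : Finset (Fin n))
  have hcard : ∀ J ∈ 𝒥, J.card = k := fun J hJ => (Finset.mem_powersetCard.1 hJ).2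
  let bad : ∀ J : Finset (Fin n), Finset ((J → ZMod 2) → ZMod 2) := fun J =>
    Finset.univ.filter fun h => ¬ SeparatesAffineMaps (r + 6) h
  let good : ∀ J : Finset (Fin n), Finset ((J → ZMod 2) → ZMod 2) := fun J =>
    Finset.univ.filter fun h => SeparatesAffineMaps (r + 6) h
  have hbad : ∀ J ∈ 𝒥, (bad J).card * 2 ^ k ≤ 2 ^ 2 ^ k := by
    intro J hJ
    have hJk : Fintype.card J = k := by simpa using hcard J hJ
    have := card_not_separatesAffineMaps_le (ι := J) (r := r) (by rwa [hJk])
    rw [hJk] at this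
    exact this
  have hgood : ∀ J ∈ 𝒥, 2 ^ 2 ^ k ≤ 2 * (good J).card := by
    intro J hJ
    have hJk : Fintype.card J = k := by simpa using hcard J hJ
    have h1 : (good J).card + (bad J).card = 2 ^ 2 ^ k := by
      rw [Finset.card_filter_add_card_filter_not, Finset.card_univ]
      simp only [Fintype.card_pi, ZMod.card, Finset.prod_const, Finset.card_univ, hJk]
    have h2 := hbad J hJ
    have h3 : (bad J).card * 2 ≤ (bad J).card * 2 ^ k :=
      Nat.mul_le_mul_left _ (Nat.le_self_pow (by omega) 2)
    omega
  have hupper : {f ∈ kJuntas n k |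
      ¬ NonadaptivelyLocallyCorrectable f (2 ^ (r + 6)) 0.001}.ncard ≤ ∑ J ∈ 𝒥, (bad J).card := by
    have hsub : {f ∈ kJuntas n k | ¬ NonadaptivelyLocallyCorrectable f (2 ^ (r + 6)) 0.001} ⊆
        ((𝒥.biUnion fun J => (bad J).image (juntaOn J) : Finset (BoolFun n)) :
          Set (BoolFun n)) := by
      rintro f ⟨hf, hnc⟩
      obtain ⟨J, hJ, h, rfl⟩ := exists_eq_juntaOn hkn hf
      rw [Finset.mem_coe, Finset.mem_biUnion]
      refine ⟨J, Finset.mem_powersetCard.2 ⟨Finset.subset_univ _, hJ⟩,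
        Finset.mem_image_of_mem _ (Finset.mem_filter.2 ⟨Finset.mem_univ _, fun hs => hnc ?_⟩)⟩
      exact hs.locallyCorrectable Subtype.val_injective (by omega)
        (by rw [Fintype.card_coe, hJ]; omega)
    refine (Set.ncard_le_ncard hsub (Finset.finite_toSet _)).trans ?_
    rw [Set.ncard_coe_finset]
    exact Finset.card_biUnion_le.trans (Finset.sum_le_sum fun J _ => Finset.card_image_le)
  have hlower : ∑ J ∈ 𝒥, (good J).card ≤ (kJuntas n k).ncard := by
    have hsub : ((𝒥.biUnion fun J => (good J).image (juntaOn J) : Finset (BoolFun n)) :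
        Set (BoolFun n)) ⊆ kJuntas n k := by
      intro f hf
      rw [Finset.mem_coe, Finset.mem_biUnion] at hf
      obtain ⟨J, hJ, hf⟩ := hf
      obtain ⟨h, -, rfl⟩ := Finset.mem_image.1 hf
      exact juntaOn_mem_kJuntas (hcard J hJ) h
    refine le_trans (le_of_eq ?_) (Set.ncard_le_ncard hsub (Set.toFinite _))
    rw [Set.ncard_coe_finset, Finset.card_biUnion]
    · exact Finset.sum_congr rfl fun J _ =>
        (Finset.card_image_of_injective _ (juntaOn_injective J)).symm
    · intro J hJ J' hJ' hne
      rw [Function.onFun, Finset.disjoint_left]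
      rintro f hf hf'
      obtain ⟨h, hh, rfl⟩ := Finset.mem_image.1 hf
      obtain ⟨h', -, heq⟩ := Finset.mem_image.1 hf'
      have hs : SeparatesAffineMaps (r + 6) h := (Finset.mem_filter.1 hh).2
      have hJk := hcard J hJ
      exact hne (Finset.eq_of_subset_of_card_le
        (hs.subset_of_juntaOn_eq (by omega) heq.symm) (by rw [hJk, hcard J' hJ']))
  calc _ ≤ 2 ^ k * ∑ J ∈ 𝒥, (bad J).card := Nat.mul_le_mul_left _ hupper
    _ ≤ ∑ J ∈ 𝒥, 2 * (good J).card := by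
      rw [Finset.mul_sum]
      refine Finset.sum_le_sum fun J hJ => ?_
      rw [mul_comm]
      exact (hbad J hJ).trans (hgood J hJ)
    _ ≤ _ := by
      rw [← Finset.mul_sum]
      exact Nat.mul_le_mul_left _ hlower

/-! ### Choice of the dimension and conclusion -/

/-- The dimension of the random subspace that is queried to correct a `k`-junta. -/
def querySubspaceDim (k : ℕ) : ℕ := Nat.log 2 k + 2 * Nat.log 2 (Nat.log 2 k)

theorem two_pow_querySubspaceDim_isBigO :
    (fun k : ℕ => ((2 ^ querySubspaceDim k : ℕ) : ℝ)) =O[atTop]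
      fun k : ℕ => (k : ℝ) * Real.log k ^ 2 := by
  -- `4 = 2 ^ 2`, from `Nat.log 2 k ≤ 2 * Real.log k`.
  refine IsBigO.of_bound 4 ?_
  filter_upwards [eventually_ge_atTop 2] with k hk
  have hL : Nat.log 2 k ≠ 0 := (Nat.log_pos (by norm_num) hk).ne'
  set L := Nat.log 2 k with hLdef
  have h1 : 2 ^ L ≤ k := Nat.pow_log_le_self 2 (by omega)
  have h2 : 2 ^ Nat.log 2 L ≤ L := Nat.pow_log_le_self 2 hL
  have h3 : 2 ^ querySubspaceDim k ≤ k * L ^ 2 := by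
    rw [querySubspaceDim, ← hLdef, pow_add, mul_comm 2, pow_mul]
    exact Nat.mul_le_mul h1 (Nat.pow_le_pow_left h2 2)
  have h4 : (L : ℝ) * Real.log 2 ≤ Real.log k := by
    rw [← Real.log_pow]
    exact Real.log_le_log (by positivity) (by exact_mod_cast h1)
  have h5 : (L : ℝ) ≤ 2 * Real.log k := by
    have := Real.log_two_gt_d9
    have hL0 : (0 : ℝ) ≤ L := by positivity
    nlinarith
  rw [Real.norm_of_nonneg (by positivity), Real.norm_of_nonneg (by positivity)]
  calc ((2 ^ querySubspaceDim k : ℕ) : ℝ) ≤ ((k * L ^ 2 : ℕ) : ℝ) := by exact_mod_cast h3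
    _ = k * (L : ℝ) ^ 2 := by push_cast; ring
    _ ≤ k * (2 * Real.log k) ^ 2 := by gcongr
    _ = _ := by ring

/-- The last inequality needs `2 ^ r` only of order `k * log k`; the second logarithm absorbs the
constants once `k` is huge. -/
theorem exists_querySubspaceDim_eq {k : ℕ} (hL : 1024 ≤ Nat.log 2 k) :
    ∃ r, querySubspaceDim k = r + 6 ∧ r + 11 ≤ k ∧ 2 ≤ r ∧
      k * (2 * (r + 7) + 1) ≤ 3 * 2 ^ r := by
  have hk0 : k ≠ 0 := by
    rintro rfl
    simp at hL
  rw [querySubspaceDim]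
  have h1 : 2 ^ Nat.log 2 k ≤ k := Nat.pow_log_le_self 2 hk0
  have h1' : k < 2 ^ (Nat.log 2 k + 1) := Nat.lt_pow_succ_log_self (by norm_num) k
  generalize Nat.log 2 k = L at hL h1 h1'
  have hL0 : L ≠ 0 := by omega
  have hs : 10 ≤ Nat.log 2 L := (Nat.le_log_iff_pow_le (by norm_num) hL0).2 (by omega)
  have h2' : L < 2 ^ (Nat.log 2 L + 1) := Nat.lt_pow_succ_log_self (by norm_num) L
  have hsL : Nat.log 2 L ≤ L := Nat.log_le_self 2 L
  generalize Nat.log 2 L = s at hs h2' hsL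
  obtain ⟨m, rfl⟩ : ∃ m, L = m + 6 := ⟨L - 6, by omega⟩
  refine ⟨m + 2 * s, by ring, ?_, by omega, ?_⟩
  · have h3 : m < 2 ^ m := Nat.lt_two_pow_self
    have h4 : 2 ^ (m + 6) = 64 * 2 ^ m := by ring
    omega
  · obtain ⟨t, rfl⟩ : ∃ t, s = t + 10 := ⟨s - 10, by omega⟩
    have h5 : 2 * (m + 2 * (t + 10) + 7) + 1 ≤ 14 * 2 ^ (t + 10) := by
      rw [pow_succ] at h2'
      omega
    -- `1835008 = 2 ^ 7 * 14 * 2 ^ 10`, and `3145728 = 3 * 2 ^ 20` comes from `2 ^ (2 * (t + 10))`.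
    calc k * (2 * (m + 2 * (t + 10) + 7) + 1)
        ≤ 2 ^ (m + 6 + 1) * (14 * 2 ^ (t + 10)) := Nat.mul_le_mul h1'.le h5
      _ = 1835008 * (2 ^ m * 2 ^ t) := by ring
      _ ≤ 1835008 * (2 ^ m * 2 ^ t) * 2 ^ t := Nat.le_mul_of_pos_right _ (by positivity)
      _ ≤ 3145728 * (2 ^ m * 2 ^ t) * 2 ^ t := by gcongr; norm_num
      _ = _ := by ring

theorem theorem1 :
    ∃ q : ℕ → ℕ,
      ((fun k : ℕ => (q k : ℝ)) =O[atTop] fun k : ℕ => (k : ℝ) * Real.log k ^ 2) ∧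
      ∃ δ : ℕ → ℝ, Tendsto δ atTop (𝓝 0) ∧
        ∀ k n : ℕ, k ≤ n →
          ({f ∈ kJuntas n k | ¬ NonadaptivelyLocallyCorrectable f (q k) 0.001}.ncard : ℝ) ≤
            δ k * ((kJuntas n k).ncard : ℝ) := by
  refine ⟨fun k => 2 ^ querySubspaceDim k, two_pow_querySubspaceDim_isBigO,
    -- For small `k` the trivial fraction `1` suffices.
    fun k => if 1024 ≤ Nat.log 2 k then 2 * (1 / 2) ^ k else 1, ?_, ?_⟩
  · have h1 : Tendsto (fun k : ℕ => 2 * (1 / 2 : ℝ) ^ k) atTop (𝓝 0) := by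
      simpa using (tendsto_pow_atTop_nhds_zero_of_lt_one (r := (1 / 2 : ℝ)) (by norm_num)
        (by norm_num)).const_mul 2
    refine h1.congr' ?_
    obtain ⟨m, hm⟩ : ∃ m, 1024 = m := ⟨_, rfl⟩
    rw [hm]
    filter_upwards [eventually_ge_atTop (2 ^ m)] with k hk
    rw [if_pos ((Nat.le_log_iff_pow_le (by norm_num)
      ((Nat.two_pow_pos m).trans_le hk).ne').2 hk)]
  · intro k n hkn
    by_cases hk : 1024 ≤ Nat.log 2 k
    · obtain ⟨r, hr, h1, h2, h3⟩ := exists_querySubspaceDim_eq hk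
      have h4 := two_pow_mul_ncard_not_correctable_le hkn h1 h2 h3
      simp only [if_pos hk, hr]
      have h5 : (0 : ℝ) < 2 ^ k := by positivity
      refine le_of_mul_le_mul_left ?_ h5
      calc _ ≤ 2 * ((kJuntas n k).ncard : ℝ) := by exact_mod_cast h4
        _ = 2 * ((2 : ℝ) ^ k * (1 / 2) ^ k) * ((kJuntas n k).ncard : ℝ) := by
          rw [← mul_pow]; norm_num
        _ = _ := by ring
    · simp only [if_neg hk, one_mul]
      exact_mod_cast Set.ncard_le_ncard (Set.sep_subset _ _) (Set.toFinite _)
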